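/- A left brace is a set $B$ with two operations $+$ and $\cdot$ such that $(B,+)$ is an abelian group, $(B,\cdot)$ is a group and $a(b+c)+a=ab+ac$ for all $a,b,c\in B$. Put $\mathcal L_a(b)=ab-a$ and $\operatorname{soc}(B)=\{a\in B: \mathcal L_a=\mathrm{id}\}$. The solution associated with $B$ is the map $\sigma: B\times B\to B\times B$, $\sigma(a,b)=(\mathcal L_a(b),\mathcal L^{-1}_{\mathcal L_a(b)}(a))$. An ideal of $B$ is a normal subgroup $I$ of $(B,\cdot)$ with $\mathcal L_a(I)\subseteq I$ for all $a\in B$; the cosets of $I$ then form a left brace $B/I$. Let $(X,r)$ be a finite solution of the YBE, that is, $X$ is a finite set and $r:X\times X\to X\times X$, $r(x,y)=({}^xy,x^y)$, satisfies $r_{12}r_{23}r_{12}=r_{23}r_{12}r_{23}$ (where $r_{12}=r\times\mathrm{id}_X$, $r_{23}=\mathrm{id}_X\times r$), $r^2=\mathrm{id}$, and the maps $y\mapsto {}^xy$ and $y\mapsto y^x$ are bijective for every $x\in X$. Let $G=G(X,r)=\langle X\mid xy=({}^xy)(x^y),\ x,y\in X\rangle$ be its structure group with its canonical left brace structure, in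 which $(G,+)$ is free abelian with basis $X$ and $\mathcal L_x(y)={}^xy$ for $x,y\in X$. **Proposition.** There is a finite left brace $(B,+,\cdot)$ with $X\subseteq B$ such that $X$ generates $(B,+)$, $X$ is invariant under the solution $\sigma$ associated with $B$ (i.e. $\sigma(X\times X)\subseteq X\times X$), and $r=\sigma|_{X\times X}$. Concretely, $n=[G:\operatorname{soc}(G)]$ is finite, $nG=\{ng: g\in G\}$ is an ideal of $G$, the left brace $G/nG$ is finite, and if $n\ge 2$ or $|X|\le 1$, then $B=G/nG$ has these properties, with $X$ embedded in it by the natural map $X\to G\to G/nG$. -/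

import Mathlib

/-- A left brace: `(B, +)` is an abelian group, `(B, ·)` is a group and
`a (b + c) + a = a b + a c`. -/
class LeftBrace (B : Type*) extends AddCommGroup B, Group B where
  mul_add_add : ∀ a b c : B, a * (b + c) + a = a * b + a * c

namespace LeftBrace

variable {B : Type*} [LeftBrace B]

theorem mul_zero' (a : B) : a * 0 = a := by
  have h := mul_add_add a 0 0
  rw [add_zero] at h
  exact (add_left_cancel h).symm

theorem zero_eq_one : (0 : B) = 1 := by
  have h := mul_zero' (1 : B)
  rwa [one_mul] at h

theorem mul_add' (a b c : B) : a * (b + c) = a * b + a * c - a :=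
  eq_sub_of_add_eq (mul_add_add a b c)

/-- The automorphism `ℒ_a (b) = a b - a` of `(B, +)`. -/
def lam (a : B) : B ≃+ B where
  toFun b := a * b - a
  invFun b := a⁻¹ * b - a⁻¹
  left_inv b := by
    have h := mul_add' a⁻¹ (a * b - a) a
    simp only [sub_add_cancel, inv_mul_cancel_left, inv_mul_cancel, ← zero_eq_one] at h
    rw [add_zero] at h
    exact h.symm
  right_inv b := by
    have h := mul_add' a (a⁻¹ * b - a⁻¹) a⁻¹
    simp only [sub_add_cancel, mul_inv_cancel_left, mul_inv_cancel, ← zero_eq_one] at h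
    rw [add_zero] at h
    exact h.symm
  map_add' b c := by
    rw [mul_add']
    abel

theorem lam_apply (a b : B) : lam a b = a * b - a := rfl

theorem lam_symm_apply (a b : B) : (lam a).symm b = lam a⁻¹ b := rfl

theorem mul_eq (a b : B) : a * b = a + lam a b := by
  rw [lam_apply]; abel

theorem lam_one (b : B) : lam 1 b = b := by
  rw [lam_apply, one_mul, ← zero_eq_one, sub_zero]

theorem lam_mul (a c b : B) : lam (a * c) b = lam a (lam c b) := by
  have h := mul_add' a (c * b - c) c
  rw [sub_add_cancel, ← mul_assoc] at h
  rw [lam_apply, lam_apply, lam_apply, h]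
  abel

variable (B) in
/-- The socle `{a ∣ ℒ_a = id}` of a left brace, the kernel of `ℒ : (B, ·) → Aut (B, +)`, as a
subgroup of `(B, ·)`. -/
def soc : Subgroup B where
  carrier := {a | lam a = AddEquiv.refl B}
  one_mem' := AddEquiv.ext lam_one
  mul_mem' := by
    intro a b ha hb
    refine AddEquiv.ext fun c => ?_
    have ha' : lam a = AddEquiv.refl B := ha
    have hb' : lam b = AddEquiv.refl B := hb
    rw [lam_mul, ha', hb']
    rfl
  inv_mem' := by
    intro a ha
    refine AddEquiv.ext fun c => ?_
    have ha' : lam a = AddEquiv.refl B := ha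
    rw [← lam_symm_apply, ha']
    rfl

variable (B) in
/-- The map `B × B → B × B`, `(a, b) ↦ (ℒ_a (b), ℒ_{ℒ_a (b)}⁻¹ (a))`, associated with the left
brace `B`. -/
def assocMap : B × B → B × B :=
  fun (a, b) => (lam a b, (lam (lam a b)).symm a)

/-- An ideal of a left brace: a normal subgroup of the multiplicative group that is invariant
under all `ℒ_a`. -/
structure BraceIdeal (B : Type*) [LeftBrace B] extends Subgroup B where
  normal' : toSubgroup.Normal
  lam_mem' : ∀ a b : B, b ∈ carrier → lam a b ∈ carrier

namespace BraceIdeal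

variable (I : BraceIdeal B)

instance : I.toSubgroup.Normal := I.normal'

theorem lam_mem (a : B) {b : B} (hb : b ∈ I.toSubgroup) : lam a b ∈ I.toSubgroup :=
  I.lam_mem' a b hb

/-- An ideal is also a subgroup of the additive group. -/
def toAddSubgroup : AddSubgroup B where
  carrier := I.carrier
  zero_mem' := by
    rw [zero_eq_one]
    exact I.one_mem'
  add_mem' := by
    intro a b ha hb
    have h : a + b = a * lam a⁻¹ b := by
      rw [mul_eq, ← lam_mul, mul_inv_cancel, lam_one]
    rw [h]
    exact I.mul_mem' ha (I.lam_mem' _ _ hb)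
  neg_mem' := by
    intro a ha
    have h : -a = lam a a⁻¹ := by
      rw [lam_apply, mul_inv_cancel, ← zero_eq_one, zero_sub]
    rw [h]
    exact I.lam_mem' _ _ (I.inv_mem' ha)

theorem inv_mul_mem_iff (a b : B) : a⁻¹ * b ∈ I.toSubgroup ↔ -a + b ∈ I.toAddSubgroup := by
  have h : lam a (a⁻¹ * b) = -a + b := by
    rw [lam_apply, mul_inv_cancel_left, sub_eq_neg_add]
  constructor
  · intro hab
    rw [← h]
    exact I.lam_mem a hab
  · intro hab
    have h2 : a⁻¹ * b = lam a⁻¹ (-a + b) := by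
      rw [← h, ← lam_mul, inv_mul_cancel, lam_one]
    rw [h2]
    exact I.lam_mem _ hab

/-- The additive and multiplicative cosets of an ideal agree, so that the multiplicative coset
relation is also an additive congruence. -/
def addCon : AddCon B where
  toSetoid := QuotientGroup.leftRel I.toSubgroup
  add' := by
    intro a b c d hab hcd
    rw [QuotientGroup.leftRel_apply, inv_mul_mem_iff] at *
    have h : -(a + c) + (b + d) = (-a + b) + (-c + d) := by abel
    rw [h]
    exact add_mem hab hcd

/-- The quotient of a left brace by an ideal: the set of cosets, with the quotient
multiplication and the quotient addition. -/
def Quot : Type _ := B ⧸ I.toSubgroup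

/-- The natural map from a left brace to its quotient by an ideal. -/
def proj (b : B) : I.Quot := (QuotientGroup.mk b : B ⧸ I.toSubgroup)

instance : Group I.Quot := inferInstanceAs (Group (B ⧸ I.toSubgroup))

instance : AddCommGroup I.Quot := inferInstanceAs (AddCommGroup I.addCon.Quotient)

theorem proj_surjective : Function.Surjective I.proj := QuotientGroup.mk_surjective

theorem proj_mul (a b : B) : I.proj (a * b) = I.proj a * I.proj b := rfl

theorem proj_add (a b : B) : I.proj (a + b) = I.proj a + I.proj b := rfl

instance : LeftBrace I.Quot where
  mul_add_add := by
    intro a b c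
    obtain ⟨a, rfl⟩ := I.proj_surjective a
    obtain ⟨b, rfl⟩ := I.proj_surjective b
    obtain ⟨c, rfl⟩ := I.proj_surjective c
    rw [← proj_add, ← proj_mul, ← proj_add, mul_add_add, proj_add, proj_mul, proj_mul]

end BraceIdeal

end LeftBrace

/-- The map `r × id` on `X × X × X`. -/
def r₁₂ {X : Type*} (r : X × X → X × X) : X × X × X → X × X × X :=
  fun t => ((r (t.1, t.2.1)).1, (r (t.1, t.2.1)).2, t.2.2)

/-- The map `id × r` on `X × X × X`. -/
def r₂₃ {X : Type*} (r : X × X → X × X) : X × X × X → X × X × X :=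
  fun t => (t.1, r t.2)

/-- A solution of the YBE on `X`: a non-degenerate involutive set-theoretic solution of the
Yang-Baxter equation. Here `r (x, y) = (ˣy, xʸ)`. -/
structure YBESolution (X : Type*) where
  r : X × X → X × X
  yang_baxter : r₁₂ r ∘ r₂₃ r ∘ r₁₂ r = r₂₃ r ∘ r₁₂ r ∘ r₂₃ r
  bijective_left : ∀ x, Function.Bijective fun y => (r (x, y)).1
  bijective_right : ∀ x, Function.Bijective fun y => (r (y, x)).2
  involutive : r ∘ r = id

namespace YBESolution

theorem perm_apply_inv {α : Type*} (e : Equiv.Perm α) (a : α) : e (e⁻¹ a) = a :=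
  Equiv.apply_symm_apply e a

theorem perm_inv_apply {α : Type*} (e : Equiv.Perm α) (a : α) : e⁻¹ (e a) = a :=
  Equiv.symm_apply_apply e a

variable {X : Type*} (S : YBESolution X)

/-- The relators `x y ((ˣy) (xʸ))⁻¹`, for `x, y ∈ X`. -/
def relators : Set (FreeGroup X) :=
  {w | ∃ x y : X, w = FreeGroup.of x * FreeGroup.of y *
    (FreeGroup.of (S.r (x, y)).1 * FreeGroup.of (S.r (x, y)).2)⁻¹}

/-- The structure group `G(X,r) = ⟨X ∣ x y = (ˣy) (xʸ), x, y ∈ X⟩`. -/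
def StructureGroup : Type _ := PresentedGroup S.relators

instance : Group S.StructureGroup := inferInstanceAs (Group (PresentedGroup S.relators))

/-- The natural map `X → G(X,r)`. -/
def ι (x : X) : S.StructureGroup := PresentedGroup.of (rels := S.relators) x

theorem ι_rel (x y : X) : S.ι x * S.ι y = S.ι (S.r (x, y)).1 * S.ι (S.r (x, y)).2 :=
  mul_inv_eq_one.1 (PresentedGroup.one_of_mem (rels := S.relators) ⟨x, y, rfl⟩)

/-- The universal property of the structure group. -/
def lift {H : Type*} [Group H] (f : X → H)
    (hf : ∀ x y, f x * f y = f (S.r (x, y)).1 * f (S.r (x, y)).2) : S.StructureGroup →* H :=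
  PresentedGroup.toGroup (rels := S.relators) (f := f) (by
    rintro _ ⟨x, y, rfl⟩
    simp [hf x y])

theorem lift_ι {H : Type*} [Group H] (f : X → H)
    (hf : ∀ x y, f x * f y = f (S.r (x, y)).1 * f (S.r (x, y)).2) (x : X) :
    S.lift f hf (S.ι x) = f x :=
  PresentedGroup.toGroup.of _

theorem induction_right {p : S.StructureGroup → Prop} (g : S.StructureGroup) (one : p 1)
    (mul : ∀ g x, p g → p (g * S.ι x)) (inv : ∀ g x, p g → p (g * (S.ι x)⁻¹)) : p g := by
  have key : g ∈ Subgroup.closure (Set.range S.ι) := by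
    have h : Subgroup.closure (Set.range S.ι) = ⊤ :=
      PresentedGroup.closure_range_of S.relators
    rw [h]; trivial
  induction key using Subgroup.closure_induction_right with
  | one => exact one
  | mul_right a _ b hb ih => obtain ⟨x, rfl⟩ := hb; exact mul _ _ ih
  | mul_inv_cancel a _ b hb ih => obtain ⟨x, rfl⟩ := hb; exact inv _ _ ih

/-- The permutation `y ↦ ˣy` of `X`. -/
noncomputable def σ (x : X) : Equiv.Perm X := Equiv.ofBijective _ (S.bijective_left x)

theorem σ_apply (x y : X) : S.σ x y = (S.r (x, y)).1 := rfl

theorem r_r (p : X × X) : S.r (S.r p) = p := congrFun S.involutive p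

theorem σ_fst_snd (x y : X) : S.σ (S.r (x, y)).1 (S.r (x, y)).2 = x := by
  rw [σ_apply, Prod.mk.eta, r_r]

theorem snd_eq (x y : X) : (S.r (x, y)).2 = (S.σ (S.σ x y))⁻¹ x := by
  rw [Equiv.Perm.eq_inv_iff_eq]; exact S.σ_fst_snd x y

theorem σ_rel (x y : X) : S.σ x * S.σ y = S.σ (S.r (x, y)).1 * S.σ (S.r (x, y)).2 := by
  ext z
  have h := congrArg Prod.fst (congrFun S.yang_baxter (x, y, z))
  exact h.symm

/-- For every `y` there is a unique `x` with `ˣy = x`. -/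
theorem bijective_diag : Function.Bijective fun x => (S.σ x)⁻¹ x := by
  constructor
  · intro x z h
    have key : ∀ u, (S.r (u, (S.σ u)⁻¹ u)).2 = (S.σ u)⁻¹ u := by
      intro u
      rw [snd_eq, perm_apply_inv]
    refine (S.bijective_right ((S.σ x)⁻¹ x)).1 ?_
    change (S.r (x, (S.σ x)⁻¹ x)).2 = (S.r (z, (S.σ x)⁻¹ x)).2
    change (S.σ x)⁻¹ x = (S.σ z)⁻¹ z at h
    rw [key x]
    rw [h, key z]
  · intro y
    obtain ⟨x, hx⟩ := (S.bijective_right y).2 y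
    change (S.r (x, y)).2 = y at hx
    refine ⟨x, ?_⟩
    change (S.σ x)⁻¹ x = y
    have h1 : S.r ((S.r (x, y)).1, y) = (x, y) := by
      have := S.r_r (x, y)
      rwa [← Prod.mk.eta (p := S.r (x, y)), hx] at this
    have h2 : (S.r (x, y)).1 = x := by
      refine (S.bijective_right y).1 ?_
      change (S.r ((S.r (x, y)).1, y)).2 = (S.r (x, y)).2
      rw [h1, hx]
    rw [Equiv.Perm.inv_eq_iff_eq, σ_apply, h2]

/-- The left action of `G(X,r)` on `X` that extends `x ↦ (y ↦ ˣy)`. -/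
noncomputable def act : S.StructureGroup →* Equiv.Perm X := S.lift S.σ S.σ_rel

theorem act_ι (x : X) : S.act (S.ι x) = S.σ x := S.lift_ι _ _ x

/-- The affine permutation `v ↦ x + ˣv` of the free abelian group on `X`. -/
noncomputable def affine (x : X) : Equiv.Perm (X →₀ ℤ) :=
  (Finsupp.domCongr (S.σ x) : (X →₀ ℤ) ≃+ (X →₀ ℤ)).toEquiv.trans
    (Equiv.addLeft (Finsupp.single x 1))

theorem affine_apply (x : X) (v : X →₀ ℤ) :
    S.affine x v = Finsupp.single x 1 + Finsupp.equivMapDomain (S.σ x) v := rfl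

theorem equivMapDomain_mul (e f : Equiv.Perm X) (v : X →₀ ℤ) :
    Finsupp.equivMapDomain (e * f) v =
      Finsupp.equivMapDomain e (Finsupp.equivMapDomain f v) :=
  Finsupp.equivMapDomain_trans f e v

theorem equivMapDomain_add (e : Equiv.Perm X) (v w : X →₀ ℤ) :
    Finsupp.equivMapDomain e (v + w) =
      Finsupp.equivMapDomain e v + Finsupp.equivMapDomain e w :=
  map_add (Finsupp.domCongr e : (X →₀ ℤ) ≃+ (X →₀ ℤ)) v w

theorem affine_rel (x y : X) :
    S.affine x * S.affine y = S.affine (S.r (x, y)).1 * S.affine (S.r (x, y)).2 := by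
  refine Equiv.ext fun v => ?_
  rw [Equiv.Perm.mul_apply, Equiv.Perm.mul_apply]
  simp only [affine_apply, equivMapDomain_add, Finsupp.equivMapDomain_single,
    ← equivMapDomain_mul, S.σ_rel x y, σ_fst_snd]
  rw [← add_assoc, ← add_assoc, σ_apply, add_comm (Finsupp.single x 1)]

/-- The affine action of `G(X,r)` on the free abelian group on `X`. -/
noncomputable def affineAct : S.StructureGroup →* Equiv.Perm (X →₀ ℤ) :=
  S.lift S.affine S.affine_rel

/-- The cocycle `π : G(X,r) → ℤ^(X)` with `π (x) = x` and `π (g h) = π (g) + ᵍπ (h)`. -/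
noncomputable def cocycle (g : S.StructureGroup) : X →₀ ℤ := S.affineAct g 0

theorem cocycle_one : S.cocycle 1 = 0 := by
  rw [cocycle, map_one, Equiv.Perm.one_apply]

theorem affineAct_apply (g : S.StructureGroup) (v : X →₀ ℤ) :
    S.affineAct g v = S.cocycle g + Finsupp.equivMapDomain (S.act g) v := by
  have hx : ∀ (x : X) (v : X →₀ ℤ), S.affineAct (S.ι x) v =
      Finsupp.single x 1 + Finsupp.equivMapDomain (S.act (S.ι x)) v := by
    intro x v
    rw [affineAct, lift_ι, affine_apply, act_ι]
  induction g using S.induction_right generalizing v with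
  | one =>
    rw [cocycle_one, map_one, map_one, zero_add, Equiv.Perm.one_apply]
    exact (Finsupp.equivMapDomain_refl v).symm
  | mul g x ih =>
    rw [cocycle, map_mul, map_mul, Equiv.Perm.mul_apply, Equiv.Perm.mul_apply, ih, ih, hx, hx,
      equivMapDomain_add, equivMapDomain_add, ← equivMapDomain_mul, ← equivMapDomain_mul,
      Finsupp.equivMapDomain_zero, add_zero, add_assoc]
  | inv g x ih =>
    have hi : ∀ v : X →₀ ℤ, S.affineAct (S.ι x)⁻¹ v =
        Finsupp.equivMapDomain (S.act (S.ι x)⁻¹) (-Finsupp.single x 1) +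
          Finsupp.equivMapDomain (S.act (S.ι x)⁻¹) v := by
      intro v
      rw [map_inv, Equiv.Perm.inv_eq_iff_eq, hx, equivMapDomain_add, ← equivMapDomain_mul,
        ← equivMapDomain_mul, ← map_mul, mul_inv_cancel, map_one]
      change v = _ + (Finsupp.equivMapDomain (Equiv.refl X) _ +
        Finsupp.equivMapDomain (Equiv.refl X) _)
      rw [Finsupp.equivMapDomain_refl, Finsupp.equivMapDomain_refl]
      abel
    rw [cocycle, map_mul, map_mul, Equiv.Perm.mul_apply, Equiv.Perm.mul_apply, ih, ih, hi, hi,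
      equivMapDomain_add, equivMapDomain_add, ← equivMapDomain_mul, ← equivMapDomain_mul,
      Finsupp.equivMapDomain_zero, Finsupp.equivMapDomain_zero, add_zero, add_assoc]

theorem cocycle_mul (g h : S.StructureGroup) :
    S.cocycle (g * h) = S.cocycle g + Finsupp.equivMapDomain (S.act g) (S.cocycle h) := by
  rw [← affineAct_apply, cocycle, map_mul, Equiv.Perm.mul_apply, cocycle]

theorem cocycle_ι (x : X) : S.cocycle (S.ι x) = Finsupp.single x 1 := by
  rw [cocycle, affineAct, lift_ι, affine_apply, Finsupp.equivMapDomain_zero, add_zero]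

/-- The permutation `x ↦ (ˣ·)⁻¹ (x)` of `X`. -/
noncomputable def diag : Equiv.Perm X := Equiv.ofBijective _ S.bijective_diag

theorem σ_diag (x : X) : S.σ x (S.diag x) = x := Equiv.apply_symm_apply (S.σ x) x

/-- The permutation `g ↦ g · (g⁻¹ acting on x)` of `G(X,r)`: addition of `x`. -/
noncomputable def translate (x : X) : Equiv.Perm S.StructureGroup where
  toFun g := g * S.ι ((S.act g)⁻¹ x)
  invFun h := h * (S.ι (S.diag.symm ((S.act h)⁻¹ x)))⁻¹
  left_inv g := by
    have h : S.diag.symm ((S.act (g * S.ι ((S.act g)⁻¹ x)))⁻¹ x) = (S.act g)⁻¹ x := by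
      rw [Equiv.symm_apply_eq, map_mul, mul_inv_rev, Equiv.Perm.mul_apply, act_ι]
      rfl
    change g * S.ι ((S.act g)⁻¹ x) * _ = g
    rw [h, mul_inv_cancel_right]
  right_inv h := by
    set u := S.diag.symm ((S.act h)⁻¹ x) with hu
    have h2 : (S.act (h * (S.ι u)⁻¹))⁻¹ x = u := by
      have h3 : S.diag u = (S.act h)⁻¹ x := by rw [hu, Equiv.apply_symm_apply]
      rw [map_mul, map_inv, mul_inv_rev, inv_inv, Equiv.Perm.mul_apply, ← h3, act_ι, σ_diag]
    change h * (S.ι u)⁻¹ * S.ι ((S.act (h * (S.ι u)⁻¹))⁻¹ x) = h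
    rw [h2, inv_mul_cancel_right]

theorem translate_apply (x : X) (g : S.StructureGroup) :
    S.translate x g = g * S.ι ((S.act g)⁻¹ x) := rfl

theorem translate_comm (x y : X) :
    S.translate x * S.translate y = S.translate y * S.translate x := by
  have key : ∀ a b : X, S.ι a * S.ι ((S.σ a)⁻¹ b) = S.ι b * S.ι ((S.σ b)⁻¹ a) := by
    intro a b
    have h1 : (S.r (a, (S.σ a)⁻¹ b)).1 = b := by
      rw [← σ_apply, perm_apply_inv]
    rw [ι_rel, snd_eq, σ_apply, h1]
  refine Equiv.ext fun g => ?_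
  simp only [Equiv.Perm.mul_apply, translate_apply, map_mul, mul_inv_rev, act_ι, mul_assoc, key]

theorem cocycle_translate (x : X) (g : S.StructureGroup) :
    S.cocycle (S.translate x g) = S.cocycle g + Finsupp.single x 1 := by
  rw [translate_apply, cocycle_mul, cocycle_ι, Finsupp.equivMapDomain_single,
    perm_apply_inv]

theorem cocycle_translate_inv (x : X) (g : S.StructureGroup) :
    S.cocycle ((S.translate x)⁻¹ g) = S.cocycle g - Finsupp.single x 1 := by
  rw [eq_sub_iff_add_eq, ← cocycle_translate, perm_apply_inv]

theorem cocycle_bijective : Function.Bijective S.cocycle := by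
  let C : Subgroup (Equiv.Perm S.StructureGroup) := Subgroup.closure (Set.range S.translate)
  -- an element of `C` that moves `1` to `g` adds `cocycle g`
  have hadd : ∀ a ∈ C, ∀ g, S.cocycle (a g) = S.cocycle g + S.cocycle (a 1) := by
    intro a ha
    induction ha using Subgroup.closure_induction with
    | mem _ h =>
      obtain ⟨x, rfl⟩ := h
      intro g
      rw [cocycle_translate, cocycle_translate, cocycle_one, zero_add]
    | one => intro g; simp [cocycle_one]
    | mul a b _ _ iha ihb =>
      intro g
      rw [Equiv.Perm.mul_apply, iha, ihb, Equiv.Perm.mul_apply, iha (b 1), add_assoc]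
    | inv a _ iha =>
      intro g
      have h1 := iha (a⁻¹ g)
      have h2 := iha (a⁻¹ 1)
      rw [perm_apply_inv] at h1 h2
      rw [cocycle_one] at h2
      rw [h1, add_assoc, add_comm (S.cocycle (a 1)), ← h2, add_zero]
  have hC : IsMulCommutative C := Subgroup.isMulCommutative_closure (by
    rintro _ ⟨x, rfl⟩ _ ⟨y, rfl⟩; exact S.translate_comm x y)
  let _ : CommGroup C := { (inferInstance : Group C) with mul_comm := mul_comm' }
  let T : X → C := fun x => ⟨S.translate x, Subgroup.subset_closure ⟨x, rfl⟩⟩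
  let F : (X →₀ ℤ) →+ Additive C := Finsupp.liftAddHom fun x =>
    zmultiplesHom (Additive C) (Additive.ofMul (T x))
  have hF : ∀ x, F (Finsupp.single x 1) = Additive.ofMul (T x) := by
    intro x
    simp [F]
  let s : (X →₀ ℤ) → S.StructureGroup := fun v => (F v).toMul.1 1
  have hs_add : ∀ v x, s (v + Finsupp.single x 1) = S.translate x (s v) := by
    intro v x
    have h : F (v + Finsupp.single x 1) = Additive.ofMul (T x) + F v := by
      rw [map_add, hF, add_comm]
    change (F (v + Finsupp.single x 1)).toMul.1 1 = _
    rw [h]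
    rfl
  have hs_surj : Function.Surjective s := by
    intro g
    induction g using S.induction_right with
    | one =>
      refine ⟨0, ?_⟩
      change (F 0).toMul.1 1 = 1
      rw [map_zero]
      rfl
    | mul g x ih =>
      obtain ⟨v, rfl⟩ := ih
      refine ⟨v + Finsupp.single (S.act (s v) x) 1, ?_⟩
      rw [hs_add, translate_apply, perm_inv_apply]
    | inv g x ih =>
      obtain ⟨v, rfl⟩ := ih
      refine ⟨v - Finsupp.single (S.act (s v) (S.diag x)) 1, ?_⟩
      have h := hs_add (v - Finsupp.single (S.act (s v) (S.diag x)) 1) (S.act (s v) (S.diag x))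
      rw [sub_add_cancel] at h
      rw [← Equiv.symm_apply_eq] at h
      rw [← h]
      change s v * (S.ι (S.diag.symm ((S.act (s v))⁻¹ (S.act (s v) (S.diag x)))))⁻¹ = _
      rw [perm_inv_apply, Equiv.symm_apply_apply]
  let P : Additive C →+ (X →₀ ℤ) :=
    AddMonoidHom.mk' (fun a => S.cocycle (a.toMul.1 1)) (by
      intro a b
      change S.cocycle (a.toMul.1 (b.toMul.1 1)) = _
      rw [hadd _ a.toMul.2, add_comm])
  have hPF : P.comp F = AddMonoidHom.id _ := by
    refine Finsupp.addHom_ext' fun x => AddMonoidHom.ext_int ?_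
    change P (F (Finsupp.single x 1)) = Finsupp.single x 1
    rw [hF]
    change S.cocycle (S.translate x 1) = _
    rw [cocycle_translate, cocycle_one, zero_add]
  have hs : ∀ v, S.cocycle (s v) = v := fun v => DFunLike.congr_fun hPF v
  refine ⟨?_, fun v => ⟨s v, hs v⟩⟩
  intro g h hgh
  obtain ⟨v, rfl⟩ := hs_surj g
  obtain ⟨w, rfl⟩ := hs_surj h
  rw [hs, hs] at hgh
  rw [hgh]

/-- The bijective cocycle `G(X,r) ≃ ℤ^(X)`. -/
noncomputable def cocycleEquiv : S.StructureGroup ≃ (X →₀ ℤ) :=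
  Equiv.ofBijective S.cocycle S.cocycle_bijective

noncomputable instance : AddCommGroup S.StructureGroup := S.cocycleEquiv.addCommGroup

theorem cocycle_add (g h : S.StructureGroup) :
    S.cocycle (g + h) = S.cocycle g + S.cocycle h :=
  S.cocycleEquiv.apply_symm_apply _

/-- The canonical left brace structure on `G(X,r)`: the multiplication is that of the structure
group, the addition is the one for which `π : G(X,r) → ℤ^(X)` is additive. -/
noncomputable instance : LeftBrace S.StructureGroup where
  mul_add_add := by
    intro a b c
    apply S.cocycle_bijective.1
    simp only [cocycle_add, cocycle_mul, equivMapDomain_add]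
    abel

/-- The additive group of `G(X,r)` is free abelian with basis `X`. -/
noncomputable def basis : Module.Basis X ℤ S.StructureGroup :=
  .ofRepr (AddEquiv.toIntLinearEquiv
    { S.cocycleEquiv with map_add' := S.cocycle_add })

theorem basis_apply (x : X) : S.basis x = S.ι x := by
  rw [← S.basis.repr.injective.eq_iff, Module.Basis.repr_self]
  exact (S.cocycle_ι x).symm

/-- In the canonical left brace structure on `G(X,r)`, `ℒ_x (y) = ˣy` for `x, y ∈ X`. -/
theorem lam_ι (x y : X) :
    LeftBrace.lam (S.ι x) (S.ι y) = S.ι (S.r (x, y)).1 := by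
  rw [LeftBrace.lam_apply, sub_eq_iff_eq_add]
  apply S.cocycle_bijective.1
  rw [cocycle_mul, cocycle_add, S.cocycle_ι x, S.cocycle_ι y, S.cocycle_ι (S.r (x, y)).1, act_ι,
    Finsupp.equivMapDomain_single, σ_apply, add_comm]

/-- `f` identifies `X` with a subset of the left brace `B` that generates `(B, +)`, in such a way
that `X` is invariant under the map `B × B → B × B` associated with `B`, whose restriction to
`X × X` is `r`. -/
structure IsGeneratingEmbedding (B : Type*) [LeftBrace B] (f : X → B) : Prop where
  injective : Function.Injective f
  closure_range : AddSubgroup.closure (Set.range f) = ⊤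
  assocMap_eq : ∀ x y : X,
    LeftBrace.assocMap B (f x, f y) = (f (S.r (x, y)).1, f (S.r (x, y)).2)

end YBESolution

universe u

/-! Write `n` for the index of the socle. The structure group acts on its additive basis `X` through
the finite group of permutations of `X`, and the kernel of this action lies in the socle
(`ker_act_le_soc`), so `n` is finite. The socle is an ideal, hence additive and multiplicative
cosets agree and Lagrange's theorem in the additive quotient puts `n • g` in the socle
(`index_nsmul_mem`).

Inside the socle multiplication is addition and conjugation by `g` is `lam g`, which is additive. So
for each multiple `m` of `n` the set of all `m • g` is a normal, `lam`-invariant subgroup, i.e. an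
ideal (`nsmulIdeal`). For `m ≠ 0` the quotient is a finitely generated torsion abelian group, hence
finite. For `m ≥ 2` distinct basis elements stay distinct modulo `m` (`ι_injective_mod`), and the
formula for the associated map passes to the quotient. Existence for every `X` comes from `m = 2n`,
which also covers `n = 1`. -/

namespace LeftBrace

section

variable {B : Type*} [LeftBrace B]

/-! ### The socle is an ideal -/

theorem mem_soc_iff {a : B} : a ∈ soc B ↔ ∀ b, lam a b = b :=
  ⟨fun h b => DFunLike.congr_fun (show lam a = AddEquiv.refl B from h) b,
    fun h => show lam a = AddEquiv.refl B from AddEquiv.ext h⟩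

/-- Both sides equal `g + lam g a`: on the right, the left factor is in the socle, so that product
is a sum. -/
theorem mul_eq_lam_mul {a : B} (g : B) (ha : lam g a ∈ soc B) : g * a = lam g a * g := by
  rw [mul_eq, mul_eq, mem_soc_iff.1 ha, add_comm]

theorem conj_eq_lam {a : B} (g : B) (ha : lam g a ∈ soc B) : g * a * g⁻¹ = lam g a := by
  rw [mul_eq_lam_mul g ha, mul_inv_cancel_right]

/-- The socle is the kernel of `lam`, so it is closed under conjugation, and `lam g a` is the
conjugate of `a` by `g`. The latter is derived directly from `a * g⁻¹ = a + g⁻¹`, since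
`conj_eq_lam` presupposes the conclusion. -/
theorem lam_mem_soc (g : B) {a : B} (ha : a ∈ soc B) : lam g a ∈ soc B := by
  have h : lam g a = g * a * g⁻¹ := by
    have h1 : lam a g⁻¹ = g⁻¹ := mem_soc_iff.1 ha _
    have h2 : lam g g⁻¹ = -g := by rw [lam_apply, mul_inv_cancel, ← zero_eq_one, zero_sub]
    rw [mul_assoc, mul_eq a, h1, mul_eq, map_add, h2]
    abel
  rw [h, mem_soc_iff]
  intro b
  rw [lam_mul, lam_mul, mem_soc_iff.1 ha, ← lam_mul, mul_inv_cancel, lam_one]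

variable (B) in
/-- The socle as an ideal. -/
def socIdeal : BraceIdeal B where
  toSubgroup := soc B
  normal' := ⟨fun a ha g => by
    rw [conj_eq_lam g (lam_mem_soc g ha)]
    exact lam_mem_soc g ha⟩
  lam_mem' g _ ha := lam_mem_soc g ha

/-! ### Quotients by ideals -/

namespace BraceIdeal

variable (I : BraceIdeal B)

/-- The natural map to the quotient as a homomorphism of additive groups. -/
def projHom : B →+ I.Quot := AddMonoidHom.mk' I.proj I.proj_add

theorem proj_eq_iff (a b : B) : I.proj a = I.proj b ↔ -a + b ∈ I.toAddSubgroup := by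
  rw [← inv_mul_mem_iff]
  exact QuotientGroup.eq

theorem proj_lam (a b : B) : I.proj (lam a b) = lam (I.proj a) (I.proj b) := by
  rw [lam_apply, lam_apply, ← proj_mul]
  exact map_sub I.projHom (a * b) a

theorem natCard_quot : Nat.card I.Quot = I.toSubgroup.index := rfl

/-- The additive group of the quotient has the multiplicative index as its order, so Lagrange
applies. For infinite index, the index is `0` by convention and the claim is trivial. -/
theorem index_nsmul_mem (g : B) : I.toSubgroup.index • g ∈ I.toAddSubgroup := by
  have h : I.proj 0 = I.proj (I.toSubgroup.index • g) := by
    have h1 : I.projHom (I.toSubgroup.index • g) = I.projHom 0 := by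
      rw [map_nsmul, map_zero, ← natCard_quot, card_nsmul_eq_zero']
    exact h1.symm
  rw [proj_eq_iff, neg_zero, zero_add] at h
  exact h

end BraceIdeal

/-! ### The ideal of multiples of `m` -/

theorem nsmul_mem_soc {m : ℕ} (hm : (soc B).index ∣ m) (g : B) : m • g ∈ soc B := by
  obtain ⟨k, rfl⟩ := hm
  rw [mul_nsmul']
  exact (socIdeal B).index_nsmul_mem (k • g)

/-- If `m` is a multiple of the index of the socle, then the multiples of `m` form an ideal. -/
def nsmulIdeal (m : ℕ) (hm : (soc B).index ∣ m) : BraceIdeal B where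
  carrier := {a | ∃ g : B, a = m • g}
  one_mem' := ⟨0, by rw [smul_zero, zero_eq_one]⟩
  mul_mem' := by
    rintro _ _ ⟨g, rfl⟩ ⟨h, rfl⟩
    exact ⟨g + h, by rw [mul_eq, mem_soc_iff.1 (nsmul_mem_soc hm g), smul_add]⟩
  inv_mem' := by
    rintro _ ⟨g, rfl⟩
    refine ⟨-g, inv_eq_of_mul_eq_one_right ?_⟩
    rw [mul_eq, mem_soc_iff.1 (nsmul_mem_soc hm g), smul_neg, add_neg_cancel, zero_eq_one]
  normal' := ⟨by
    rintro _ ⟨g, rfl⟩ a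
    have h : lam a (m • g) = m • lam a g := map_nsmul _ _ _
    refine ⟨lam a g, ?_⟩
    rw [conj_eq_lam, h]
    rw [h]
    exact nsmul_mem_soc hm _⟩
  lam_mem' := by
    rintro a _ ⟨g, rfl⟩
    exact ⟨lam a g, map_nsmul _ _ _⟩

theorem mem_nsmulIdeal {m : ℕ} (hm : (soc B).index ∣ m) (a : B) :
    a ∈ (nsmulIdeal m hm).toAddSubgroup ↔ ∃ g : B, a = m • g := Iff.rfl

/-- The quotient is a finitely generated abelian group killed by `m`. -/
theorem finite_quot_nsmulIdeal [AddGroup.FG B] {m : ℕ} (hm : (soc B).index ∣ m) (h0 : m ≠ 0) :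
    Finite (nsmulIdeal m hm).Quot := by
  have hfg : AddGroup.FG (nsmulIdeal m hm).Quot :=
    AddGroup.fg_of_surjective (f := (nsmulIdeal m hm).projHom) (nsmulIdeal m hm).proj_surjective
  refine AddCommGroup.finite_of_fg_isAddTorsion _ fun a => ?_
  obtain ⟨b, rfl⟩ := (nsmulIdeal m hm).proj_surjective a
  refine isOfFinAddOrder_iff_nsmul_eq_zero.2 ⟨m, Nat.pos_of_ne_zero h0, ?_⟩
  change m • (nsmulIdeal m hm).projHom b = 0
  rw [← map_nsmul, ← map_zero (nsmulIdeal m hm).projHom]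
  refine ((nsmulIdeal m hm).proj_eq_iff _ _).2 ⟨-b, ?_⟩
  rw [add_zero, smul_neg]

end

end LeftBrace

/-! ### Structure groups and their finite quotients -/

namespace YBESolution

open LeftBrace

section

variable {X : Type*} (S : YBESolution X)

theorem cocycle_lam (g h : S.StructureGroup) :
    S.cocycle (lam g h) = Finsupp.equivMapDomain (S.act g) (S.cocycle h) := by
  have h1 := S.cocycle_mul g h
  rw [mul_eq, cocycle_add] at h1
  exact add_left_cancel h1

/-- Under the bijective cocycle, `lam g` becomes the permutation of coordinates given by `S.act g`.
-/
theorem ker_act_le_soc : S.act.ker ≤ soc S.StructureGroup := by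
  intro g hg
  rw [mem_soc_iff]
  intro b
  apply S.cocycle_bijective.1
  rw [cocycle_lam, MonoidHom.mem_ker.1 hg]
  exact Finsupp.equivMapDomain_refl _

theorem index_soc_ne_zero [Finite X] : (soc S.StructureGroup).index ≠ 0 := by
  have h : S.act.ker.FiniteIndex := inferInstance
  exact (Subgroup.finiteIndex_of_le S.ker_act_le_soc).index_ne_zero

theorem closure_range_ι : AddSubgroup.closure (Set.range S.ι) = ⊤ := by
  have h : Set.range S.ι = Set.range S.basis := by
    congr 1
    exact funext fun x => (S.basis_apply x).symm
  rw [h, ← Submodule.span_int_eq_addSubgroupClosure, S.basis.span_eq]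
  rfl

instance [Finite X] : AddGroup.FG S.StructureGroup :=
  AddGroup.fg_iff.2 ⟨_, S.closure_range_ι, Set.finite_range _⟩

/-- If `x ≠ y`, the `y`-coordinate of the left side is `1`, which would be divisible by `m`. -/
theorem ι_injective_mod {m : ℕ} (hm : 2 ≤ m) {x y : X} {g : S.StructureGroup}
    (h : -S.ι x + S.ι y = m • g) : x = y := by
  classical
  by_contra hxy
  rw [← basis_apply, ← basis_apply] at h
  have h1 := DFunLike.congr_fun (congrArg S.basis.repr h) y
  simp only [map_add, map_neg, map_nsmul, Module.Basis.repr_self, Finsupp.add_apply,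
    Finsupp.neg_apply, Finsupp.smul_apply, Finsupp.single_eq_same,
    Finsupp.single_eq_of_ne (Ne.symm hxy), neg_zero, zero_add, nsmul_eq_mul] at h1
  have h2 : (m : ℤ) ∣ 1 := ⟨_, h1⟩
  have h3 : m ∣ 1 := by exact_mod_cast h2
  have := Nat.le_of_dvd one_pos h3
  omega

/-- The natural map from `X` to a quotient of the structure group is a generating embedding as
soon as it is injective. -/
theorem isGeneratingEmbedding_proj (I : BraceIdeal S.StructureGroup)
    (hI : Function.Injective fun x => I.proj (S.ι x)) :
    S.IsGeneratingEmbedding I.Quot fun x => I.proj (S.ι x) where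
  injective := hI
  closure_range := by
    have h : (Set.range fun x => I.proj (S.ι x)) = I.projHom '' Set.range S.ι :=
      Set.range_comp I.proj S.ι
    rw [h, ← AddMonoidHom.map_closure, closure_range_ι, ← AddMonoidHom.range_eq_map]
    exact AddMonoidHom.range_eq_top.2 I.proj_surjective
  assocMap_eq x y := by
    have h1 : lam (I.proj (S.ι x)) (I.proj (S.ι y)) = I.proj (S.ι (S.r (x, y)).1) := by
      rw [← BraceIdeal.proj_lam, lam_ι]
    refine Prod.ext h1 ?_
    change (lam (lam (I.proj (S.ι x)) (I.proj (S.ι y)))).symm (I.proj (S.ι x)) = _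
    -- After moving the inverse across, the claim is that `ˣy` acting on `xʸ` gives `x`, which is
    -- involutivity of `r`.
    rw [h1, AddEquiv.symm_apply_eq, ← BraceIdeal.proj_lam, lam_ι, ← σ_apply, σ_fst_snd]

theorem isGeneratingEmbedding_nsmulIdeal {m : ℕ} (hm : (soc S.StructureGroup).index ∣ m)
    (h : 2 ≤ m ∨ Subsingleton X) :
    S.IsGeneratingEmbedding (nsmulIdeal m hm).Quot fun x => (nsmulIdeal m hm).proj (S.ι x) := by
  refine S.isGeneratingEmbedding_proj _ fun x y hxy => ?_
  rcases h with h | h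
  · obtain ⟨g, hg⟩ := ((nsmulIdeal m hm).proj_eq_iff _ _).1 hxy
    exact S.ι_injective_mod h hg
  · exact Subsingleton.elim x y

end

end YBESolution

theorem proposition4p1 {X : Type u} [Finite X] (S : YBESolution X) :
    (∃ (B : Type u) (_ : LeftBrace B) (f : X → B), Finite B ∧ S.IsGeneratingEmbedding B f) ∧
    (LeftBrace.soc S.StructureGroup).index ≠ 0 ∧
    ∃ I : LeftBrace.BraceIdeal S.StructureGroup,
      (I.toSubgroup : Set S.StructureGroup) =
        {a | ∃ g : S.StructureGroup, a = (LeftBrace.soc S.StructureGroup).index • g} ∧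
      Finite I.Quot ∧
      (2 ≤ (LeftBrace.soc S.StructureGroup).index ∨ Subsingleton X →
        S.IsGeneratingEmbedding I.Quot fun x => I.proj (S.ι x)) := by
  have h0 := S.index_soc_ne_zero
  -- The factor `2` ensures a modulus of at least `2`: if the index is `1`, the quotient by all
  -- multiples of it is trivial and cannot contain a larger `X`.
  have hdvd : (LeftBrace.soc S.StructureGroup).index ∣
      (LeftBrace.soc S.StructureGroup).index * 2 := dvd_mul_right _ _
  exact ⟨⟨_, inferInstance, _, LeftBrace.finite_quot_nsmulIdeal hdvd (by omega),
    S.isGeneratingEmbedding_nsmulIdeal hdvd (Or.inl (by omega))⟩, h0,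
    LeftBrace.nsmulIdeal _ dvd_rfl, rfl, LeftBrace.finite_quot_nsmulIdeal dvd_rfl h0,
    S.isGeneratingEmbedding_nsmulIdeal dvd_rfl⟩
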